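/- Let $X$ be a random variable on a finite set $\mathcal X$ with law $p$, $p(x)>0$ for every $x\in\mathcal X$. Let $(\mathcal Z,\|\cdot-\cdot\|)$ be a metric space with its Borel $\sigma$-algebra (the distance is written $\|z-z'\|$), let $f:\mathcal X\to\mathcal Z$ and $\epsilon\ge 0$, and let $d_\epsilon(x,z)=\mathbf 1_{\{\|f(x)-z\|>\epsilon\}}$ be the maximal distortion with tolerance $\epsilon$. *Rate-distortion function.* For $R\ge 0$, an $(n,2^{nR})$ code consists of an encoder $\phi:\mathcal X^n\to\{1,\dots,\lfloor 2^{nR}\rfloor\}$ and a decoder $\varphi:\{1,\dots,\lfloor 2^{nR}\rfloor\}\to\mathcal Z^n$; with $X_1,\dots,X_n$ i.i.d. of law $p$ and $Z^n=\varphi(\phi(X^n))$, its expected maximal distortion is $\frac1n\sum_{t=1}^n\mathbb E[d_\epsilon(X_t,Z_t)]=\frac1n\sum_{t=1}^n\mathbb P[\|f(X_t)-Z_t\|>\epsilon]$. The rate $R$ is achievable if there is a sequence of $(n,2^{nR})$ codes whose expected maximal distortion tends to $0$ as $n\to\infty$, and $R[\epsilon]$ is the infimum of all achievable rates. *Maximal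 hyperedges.* An $\epsilon$-characteristic hypergraph for $f$ is given by a set $\mathcal E$ of nonempty subsets (hyperedges) of $\mathcal X$ that covers $\mathcal X$ and is such that for every $w\in\mathcal E$ the smallest enclosing circle of $\{f(x):x\in w,\ p(x)>0\}$ has radius at most $\epsilon$, i.e. these points are all within distance $\epsilon$ of some centre $c\in\mathcal Z$. Let $\Gamma^{\epsilon,f}$ be the union of the hyperedge sets of all $\epsilon$-characteristic hypergraphs, and let $\Gamma_m^{\epsilon,f}$ be the set of those $w\in\Gamma^{\epsilon,f}$ that are not a proper subset of another element of $\Gamma^{\epsilon,f}$. **Theorem.** With mutual information measured in bits, $$R[\epsilon]=\min_{p(z|x):\ \mathbb E[d_\epsilon(X,Z)]=0} I(X;Z)=\min_{p(w|x):\ X\in W\in\Gamma_m^{\epsilon,f}} I(X;W).$$ The first minimum is over all test channels $p(z|x)$ from $\mathcal X$ to $\mathcal Z$ (arbitrary, possibly continuous, conditional probability laws on $\mathcal Z$) with $\mathbb E[d_\epsilon(X,Z)]=0$. The second is over all test channels $p(w|x)$ from $\mathcal X$ to the subsets of $\mathcal X$ for which $p(w|x)$ is nonzero only when $x\in w\in\Gamma_m^{\epsilon,f}$.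 Both minima are attained, and the set $\Gamma_m^{\epsilon,f}$ of maximal hyperedges is finite. -/

import Mathlib

open MeasureTheory ProbabilityTheory Filter Topology
open scoped ENNReal

noncomputable section

namespace FunctionalCompression

/-! ### Maximal distortion -/

/-- The maximal distortion with tolerance `ε` for the function `f`: the indicator of
`dist (f x) z > ε`. -/
def maxDistortion {X Z : Type*} [MetricSpace Z] (f : X → Z) (ε : ℝ) (x : X) (z : Z) : ℝ :=
  open Classical in if ε < dist (f x) z then 1 else 0

/-! ### Block codes and the operational rate-distortion function -/

/-- Number of messages of a code of rate `R` and block length `n`: the message set is the set of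
positive integers that are at most `2 ^ (n R)`, encoded as `Fin ⌊2 ^ (n R)⌋`. -/
def numMessages (n : ℕ) (R : ℝ) : ℕ := ⌊(2 : ℝ) ^ ((n : ℝ) * R)⌋₊

/-- An `(n, 2 ^ (n R))` code: an encoder and a decoder, both deterministic. -/
structure Code (X Z : Type*) (n : ℕ) (R : ℝ) where
  enc : (Fin n → X) → Fin (numMessages n R)
  dec : Fin (numMessages n R) → (Fin n → Z)

/-- The expected maximal distortion `(1/n) ∑ t, 𝔼[d_ε(X_t, Z_t)]` of a code, the source
`X_1, …, X_n` being i.i.d. with law `p`. -/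
def Code.expDistortion {X Z : Type*} [MeasurableSpace X] [MetricSpace Z] {n : ℕ} {R : ℝ}
    (C : Code X Z n R) (p : PMF X) (f : X → Z) (ε : ℝ) : ℝ :=
  (1 / (n : ℝ)) * ∑ t : Fin n,
    ∫ x, maxDistortion f ε (x t) (C.dec (C.enc x) t) ∂(Measure.pi fun _ : Fin n => p.toMeasure)

/-- A rate `R ≥ 0` is achievable if some sequence of `(n, 2 ^ (n R))` codes has vanishing expected
maximal distortion. -/
def Achievable {X Z : Type*} [MeasurableSpace X] [MetricSpace Z]
    (p : PMF X) (f : X → Z) (ε : ℝ) (R : ℝ) : Prop :=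
  0 ≤ R ∧ ∃ C : (n : ℕ) → Code X Z n R,
    Tendsto (fun n => (C n).expDistortion p f ε) atTop (𝓝 0)

/-- The rate-distortion function `R[ε]`: the infimum of all achievable rates, as an extended
nonnegative number (so that it would be `∞` if no rate were achievable). -/
def rateDistortion {X Z : Type*} [MeasurableSpace X] [MetricSpace Z]
    (p : PMF X) (f : X → Z) (ε : ℝ) : ℝ≥0∞ :=
  sInf {r : ℝ≥0∞ | ∃ R : ℝ, Achievable p f ε R ∧ r = ENNReal.ofReal R}

/-! ### Test channels -/

/-- The mutual information `I(X; V)`, in bits, of a source `X` with law `p` and the output `V` of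
the channel `κ` with input `X`: the Kullback-Leibler divergence of the joint law from the product
of the marginal laws. -/
def mutualInfo {X V : Type*} [MeasurableSpace X] [MeasurableSpace V]
    (p : PMF X) (κ : Kernel X V) : ℝ≥0∞ :=
  InformationTheory.klDiv (p.toMeasure ⊗ₘ κ) (p.toMeasure.prod (κ ∘ₘ p.toMeasure))
    / ENNReal.ofReal (Real.log 2)

/-- The expected maximal distortion `𝔼[d_ε(X, Z)]` of a test channel `p(z|x)`. -/
def channelDistortion {X Z : Type*} [MeasurableSpace X] [MetricSpace Z] [MeasurableSpace Z]
    (p : PMF X) (κ : Kernel X Z) (f : X → Z) (ε : ℝ) : ℝ :=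
  ∫ q, maxDistortion f ε q.1 q.2 ∂(p.toMeasure ⊗ₘ κ)

/-! ### Smallest enclosing circles and characteristic hypergraphs -/

/-- `c` and `r` are the centre and the radius of a smallest enclosing circle of `S`. -/
def IsSEC {Z : Type*} [MetricSpace Z] (S : Set Z) (c : Z) (r : ℝ) : Prop :=
  0 ≤ r ∧ (∀ z ∈ S, dist z c ≤ r) ∧
    ∀ (c' : Z) (r' : ℝ), 0 ≤ r' → (∀ z ∈ S, dist z c' ≤ r') → r ≤ r'

/-- The smallest enclosing circle of `S` has radius at most `ε`: the points of `S` are enclosed by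
some circle of radius at most `ε`. This makes sense in every metric space; where a smallest
enclosing circle exists, its radius is compared with `ε`, see `secRadiusLE_iff`. -/
def SECRadiusLE {Z : Type*} [MetricSpace Z] (S : Set Z) (ε : ℝ) : Prop :=
  ∃ (c : Z) (r : ℝ), 0 ≤ r ∧ r ≤ ε ∧ ∀ z ∈ S, dist z c ≤ r

theorem secRadiusLE_iff {Z : Type*} [MetricSpace Z] {S : Set Z} {c : Z} {r : ℝ}
    (h : IsSEC S c r) (ε : ℝ) : SECRadiusLE S ε ↔ r ≤ ε :=
  ⟨fun ⟨c', r', h0, hr, hS⟩ => (h.2.2 c' r' h0 hS).trans hr,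
    fun hr => ⟨c, r, h.1, hr, h.2.1⟩⟩

/-- `E` is the hyperedge set of an `ε`-characteristic hypergraph on the vertex set `X`. -/
structure IsCharacteristicHypergraph {X Z : Type*} [MetricSpace Z]
    (p : PMF X) (f : X → Z) (ε : ℝ) (E : Set (Set X)) : Prop where
  nonempty : ∀ w ∈ E, w.Nonempty
  sec : ∀ w ∈ E, SECRadiusLE {z | ∃ x ∈ w, 0 < p x ∧ f x = z} ε
  cover : ∀ x : X, ∃ w ∈ E, x ∈ w

/-- The union of the hyperedge sets of all `ε`-characteristic hypergraphs. -/
def allHyperedges {X Z : Type*} [MetricSpace Z]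
    (p : PMF X) (f : X → Z) (ε : ℝ) : Set (Set X) :=
  {w | ∃ E : Set (Set X), IsCharacteristicHypergraph p f ε E ∧ w ∈ E}

/-- The maximal set of hyperedges: those that are not a proper subset of another hyperedge. -/
def maximalHyperedges {X Z : Type*} [MetricSpace Z]
    (p : PMF X) (f : X → Z) (ε : ℝ) : Set (Set X) :=
  {w | w ∈ allHyperedges p f ε ∧ ¬ ∃ w' ∈ allHyperedges p f ε, w ⊂ w'}

end FunctionalCompression

end

namespace FunctionalCompression

/-! ### Optimal weights -/

/-! All three quantities equal L / log 2 for one finite-dimensional problem. Among laws q on the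
maximal hyperedges, maximize ∑ p(x) log a(x), where a(x) is the q-probability that w contains x, and
let L be minus the maximum. Optimality (`exists_optimal_weights`) gives ∑_{x ∈ w} p(x)/a(x) ≤ 1 for
each maximal hyperedge w. The points x with f(x) within ε of a given z form the empty set or a
hyperedge, so the same inequality holds for every reproduction letter z
(`sum_indicator_closedBall_le_one`).

The weights 1/a are then a dual certificate. They bound the rate of block codes from below through
Jensen's inequality (`le_rate_of_achievable`) and the mutual information of both kinds of test
channel through Gibbs' inequality (`ofReal_sum_log_le_klDiv`).

The bound is attained. Random codebooks drawn from the product law q^n cover almost all source words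
at any rate above L / log 2, and centres of hyperedges serve as reproductions (`achievable_of_lt`).
Conditioning q on {w : x ∈ w} gives an optimal hyperedge channel (`exists_optimal_channel`). Mapping
each hyperedge to its centre turns it into a channel to Z of zero distortion, and data processing
shows that the information does not grow. -/

theorem deriv_nonpos_of_forall_Ioo_le {g : ℝ → ℝ} {d : ℝ} (h : HasDerivAt g d 0)
    (hle : ∀ t ∈ Set.Ioo (0 : ℝ) 1, g t ≤ g 0) : d ≤ 0 := by
  refine le_of_tendsto h.tendsto_slope_zero_right ?_
  filter_upwards [Ioo_mem_nhdsGT (zero_lt_one' ℝ)] with t ht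
  rw [zero_add, smul_eq_mul]
  exact mul_nonpos_of_nonneg_of_nonpos (inv_nonneg.2 ht.1.le) (sub_nonpos.2 (hle t ht))

/-- The weights `q` maximizing `∑ x, p x * log (∑ i, q i * m i x)` over the simplex exist and
satisfy the Karush-Kuhn-Tucker conditions. -/
theorem exists_optimal_weights {X ι : Type*} [Fintype X] [Fintype ι] [Nonempty ι]
    (p : X → ℝ) (hp : ∀ x, 0 < p x) (m : ι → X → ℝ) (hm : ∀ i x, 0 ≤ m i x)
    (hcov : ∀ x, ∃ i, 0 < m i x) :
    ∃ q ∈ stdSimplex ℝ ι, (∀ x, 0 < ∑ i, q i * m i x) ∧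
      ∀ j, ∑ x, p x * (m j x / ∑ i, q i * m i x) ≤ ∑ x, p x := by
  classical
  set A : (ι → ℝ) → X → ℝ := fun q x => ∑ i, q i * m i x with hA
  -- The exponential of the objective: unlike the sum of logarithms, it is continuous on the whole
  -- simplex, including points where some `A q x` vanishes.
  set G : (ι → ℝ) → ℝ := fun q => ∏ x, A q x ^ p x with hG
  have hGc : Continuous G := by
    refine continuous_finsetProd _ fun x _ => ?_
    exact (by fun_prop : Continuous fun q => A q x).rpow_const fun _ => Or.inr (hp x).le
  have hAnn : ∀ q ∈ stdSimplex ℝ ι, ∀ x, 0 ≤ A q x := fun q hq x =>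
    Finset.sum_nonneg fun i _ => mul_nonneg (hq.1 i) (hm i x)
  set u : ι → ℝ := fun _ => (Fintype.card ι : ℝ)⁻¹ with hu
  have hupos : ∀ i, 0 < u i := fun i => by simp [hu, Fintype.card_pos]
  have hus : u ∈ stdSimplex ℝ ι := ⟨fun i => (hupos i).le, by simp [hu]⟩
  obtain ⟨q, hq, hmax⟩ := (isCompact_stdSimplex ℝ ι).exists_isMaxOn ⟨u, hus⟩ hGc.continuousOn
  -- The uniform weights make the maximum positive, so no factor can vanish at the maximizer.
  have hGu : 0 < G u := Finset.prod_pos fun x _ => Real.rpow_pos_of_pos (by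
    obtain ⟨i, hi⟩ := hcov x
    exact Finset.sum_pos' (fun j _ => mul_nonneg (hupos j).le (hm j x))
      ⟨i, Finset.mem_univ _, mul_pos (hupos i) hi⟩) _
  have hGq : 0 < G q := hGu.trans_le (hmax hus)
  have ha : ∀ x, 0 < A q x := fun x => by
    refine (hAnn q hq x).lt_of_ne fun h0 => hGq.ne' ?_
    exact Finset.prod_eq_zero (Finset.mem_univ x) (by rw [← h0, Real.zero_rpow (hp x).ne'])
  refine ⟨q, hq, ha, fun j => ?_⟩
  have hlog : ∀ r : ι → ℝ, (∀ x, 0 < A r x) → Real.log (G r) = ∑ x, p x * Real.log (A r x) := by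
    intro r hr
    rw [hG, Real.log_prod fun x _ => (Real.rpow_pos_of_pos (hr x) _).ne']
    exact Finset.sum_congr rfl fun x _ => Real.log_rpow (hr x) _
  -- Derivative of the objective along the segment from `q` to the vertex `j`; it is nonpositive
  -- because `q` is a maximizer.
  have hd : HasDerivAt (fun t : ℝ => ∑ x, p x * Real.log (A q x + t * (m j x - A q x)))
      (∑ x, p x * ((m j x - A q x) / A q x)) 0 := by
    refine HasDerivAt.fun_sum fun x _ => HasDerivAt.const_mul _ ?_
    have h1 : HasDerivAt (fun t : ℝ => A q x + t * (m j x - A q x)) (m j x - A q x) 0 := by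
      simpa using ((hasDerivAt_id (0 : ℝ)).mul_const (m j x - A q x)).const_add (A q x)
    simpa using h1.log (by simpa using (ha x).ne')
  have hle := deriv_nonpos_of_forall_Ioo_le hd fun t ht => by
    set r : ι → ℝ := (1 - t) • q + t • Pi.single j 1 with hr
    have hrs : r ∈ stdSimplex ℝ ι := convex_stdSimplex ℝ ι hq (single_mem_stdSimplex ℝ j)
      (sub_nonneg.2 ht.2.le) ht.1.le (by ring)
    have hAr : ∀ x, A r x = A q x + t * (m j x - A q x) := fun x => by
      simp only [hA, hr, Pi.add_apply, Pi.smul_apply, smul_eq_mul, add_mul, Finset.sum_add_distrib,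
        mul_assoc, ← Finset.mul_sum]
      simp [Pi.single_apply]
      ring
    have hArp : ∀ x, 0 < A r x := fun x => by
      rw [hAr, show A q x + t * (m j x - A q x) = (1 - t) * A q x + t * m j x by ring]
      exact add_pos_of_pos_of_nonneg (mul_pos (sub_pos.2 ht.2) (ha x))
        (mul_nonneg ht.1.le (hm j x))
    have := Real.log_le_log (Finset.prod_pos fun x _ => Real.rpow_pos_of_pos (hArp x) _) (hmax hrs)
    rw [hlog r hArp, hlog q ha] at this
    simpa [hAr] using this
  have : ∀ x, p x * ((m j x - A q x) / A q x) = p x * (m j x / A q x) - p x := fun x => by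
    have := (ha x).ne'
    field_simp
  rw [Finset.sum_congr rfl fun x _ => this x, Finset.sum_sub_distrib] at hle
  linarith

/-! ### Converse -/

theorem expDistortion_eq {X Z : Type*} [Fintype X] [MeasurableSpace X] [DiscreteMeasurableSpace X]
    [MetricSpace Z] {n : ℕ} {R : ℝ} (C : Code X Z n R) (p : PMF X) (f : X → Z) (ε : ℝ) :
    C.expDistortion p f ε = (1 / (n : ℝ)) * ∑ t : Fin n, ∑ x : Fin n → X,
      (∏ s, (p (x s)).toReal) * maxDistortion f ε (x t) (C.dec (C.enc x) t) := by
  unfold Code.expDistortion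
  congr 1
  refine Finset.sum_congr rfl fun t _ => ?_
  rw [integral_fintype .of_finite]
  refine Finset.sum_congr rfl fun x _ => ?_
  simp only [measureReal_def, Measure.pi_singleton, ENNReal.toReal_prod, smul_eq_mul,
    p.toMeasure_apply_singleton _ (measurableSet_singleton _)]

theorem sum_toReal_eq_one {X : Type*} [Fintype X] (p : PMF X) : ∑ x, (p x).toReal = 1 := by
  rw [← ENNReal.toReal_sum fun x _ => p.apply_ne_top x, ← tsum_fintype (L := .unconditional X) (fun x => p x), p.tsum_coe,
    ENNReal.toReal_one]

theorem maxDistortion_nonneg {X Z : Type*} [MetricSpace Z] (f : X → Z) (ε : ℝ) (x : X) (z : Z) :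
    0 ≤ maxDistortion f ε x z := by
  unfold maxDistortion
  split_ifs <;> norm_num

theorem one_le_numMessages {n : ℕ} {R : ℝ} (hR : 0 ≤ R) : 1 ≤ numMessages n R :=
  Nat.le_floor (by simpa using Real.one_le_rpow one_le_two (by positivity))

/-- A single-letter bound on the exponent of a block code, for weights `c / a` with
`∑ x, p x * (c x z / a x) ≤ K` for every reproduction letter `z`. -/
theorem sum_log_le_of_code {X Z M : Type*} [Fintype X] [Fintype M] (p a : X → ℝ)
    (c : X → Z → ℝ) (hp : ∀ x, 0 < p x) (hp1 : ∑ x, p x = 1) (ha : ∀ x, 0 < a x)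
    (hc : ∀ x z, 0 < c x z) {K : ℝ} (hK : ∀ z, ∑ x, p x * (c x z / a x) ≤ K)
    {n : ℕ} (enc : (Fin n → X) → M) (dec : M → Fin n → Z) :
    ∑ x : Fin n → X, (∏ s, p (x s)) * Real.log (∏ t, c (x t) (dec (enc x) t) / a (x t)) ≤
      Real.log (Fintype.card M * K ^ n) := by
  have hP : ∀ x : Fin n → X, 0 < ∏ s, p (x s) := fun x => Finset.prod_pos fun s _ => hp _
  have hy : ∀ (x : Fin n → X) (k : M), 0 < ∏ t, c (x t) (dec k t) / a (x t) := fun x k =>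
    Finset.prod_pos fun t _ => div_pos (hc _ _) (ha _)
  have hP1 : ∑ x : Fin n → X, ∏ s, p (x s) = 1 := by
    rw [← Fintype.sum_pow, hp1, one_pow]
  have hJ := strictConcaveOn_log_Ioi.concaveOn.le_map_sum (t := Finset.univ)
    (w := fun x : Fin n → X => ∏ s, p (x s))
    (p := fun x => ∏ t, c (x t) (dec (enc x) t) / a (x t))
    (fun x _ => (hP x).le) hP1 (fun x _ => hy x _)
  simp only [smul_eq_mul] at hJ
  have hne : Nonempty (Fin n → X) := by
    by_contra h
    rw [not_nonempty_iff] at h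
    simp at hP1
  refine hJ.trans (Real.log_le_log
    (Finset.sum_pos (fun x _ => mul_pos (hP x) (hy x _)) Finset.univ_nonempty) ?_)
  -- The encoder is removed by summing over all messages instead of the chosen one; for a fixed
  -- message the sum over source words factors over the letters.
  calc ∑ x : Fin n → X, (∏ s, p (x s)) * ∏ t, c (x t) (dec (enc x) t) / a (x t)
      ≤ ∑ x : Fin n → X, ∑ k : M, (∏ s, p (x s)) * ∏ t, c (x t) (dec k t) / a (x t) :=
        Finset.sum_le_sum fun x _ => Finset.single_le_sum
          (f := fun k => (∏ s, p (x s)) * ∏ t, c (x t) (dec k t) / a (x t))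
          (fun k _ => (mul_pos (hP x) (hy x k)).le) (Finset.mem_univ (enc x))
    _ = ∑ k : M, ∏ t, ∑ x : X, p x * (c x (dec k t) / a x) := by
        rw [Finset.sum_comm]
        refine Finset.sum_congr rfl fun k _ => ?_
        rw [Fintype.prod_sum]
        exact Finset.sum_congr rfl fun x _ => Finset.prod_mul_distrib.symm
    _ ≤ ∑ k : M, K ^ n := by
        refine Finset.sum_le_sum fun k _ => ?_
        have h := Finset.prod_le_prod (s := Finset.univ)
          (f := fun t => ∑ x : X, p x * (c x (dec k t) / a x)) (g := fun _ => K)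
          (fun t _ => Finset.sum_nonneg fun x _ => (mul_pos (hp x) (div_pos (hc _ _) (ha _))).le)
          (fun t _ => hK (dec k t))
        simpa using h
    _ = Fintype.card M * K ^ n := by simp

theorem sum_prod_mul_sum_eq {X : Type*} [Fintype X] (p φ : X → ℝ) (hp1 : ∑ x, p x = 1) (n : ℕ) :
    ∑ x : Fin n → X, (∏ s, p (x s)) * ∑ t, φ (x t) = n * ∑ x, p x * φ x := by
  simp_rw [Finset.mul_sum]
  rw [Finset.sum_comm]
  have : ∀ t : Fin n, ∑ x : Fin n → X, (∏ s, p (x s)) * φ (x t) = ∑ x, p x * φ x := fun t => by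
    have h := Fintype.prod_sum (fun (s : Fin n) (x : X) => p x * if s = t then φ x else 1)
    simp only [Finset.prod_mul_distrib, Finset.prod_ite_eq', Finset.mem_univ, if_true] at h
    rw [← h, Finset.prod_eq_single t]
    · simp
    · intro s _ hs
      simp [hs, hp1]
    · simp
  simp [this, Finset.mul_sum]

/-- The distortion vanishes only in the limit, so the hard weight 1 - d is softened to exp(-s d) ≤
(1 - d) + exp(-s). This raises the bound in `hKKT` from 1 to 1 + exp(-s) B and costs s times the
distortion. Letting n, then s, tend to infinity removes both losses. -/
theorem le_rate_of_achievable {X Z : Type*} [Fintype X] [MeasurableSpace X]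
    [DiscreteMeasurableSpace X] [MetricSpace Z] (p : PMF X) (hp : ∀ x, 0 < p x) (f : X → Z)
    (ε : ℝ) (a : X → ℝ) (ha : ∀ x, 0 < a x)
    (hKKT : ∀ z, ∑ x, (p x).toReal * ((1 - maxDistortion f ε x z) / a x) ≤ 1)
    {R : ℝ} (hR : Achievable p f ε R) :
    ∑ x, (p x).toReal * (-Real.log (a x)) ≤ R * Real.log 2 := by
  obtain ⟨hR0, C, hC⟩ := hR
  have hpr : ∀ x, 0 < (p x).toReal := fun x => ENNReal.toReal_pos (hp x).ne' (p.apply_ne_top x)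
  have hp1 := sum_toReal_eq_one p
  set L := ∑ x, (p x).toReal * (-Real.log (a x))
  set B := ∑ x, (p x).toReal / a x with hB
  have hBnn : 0 ≤ B := Finset.sum_nonneg fun x _ => (div_pos (hpr x) (ha x)).le
  have key : ∀ (s : ℝ) (n : ℕ), 0 < n →
      L ≤ R * Real.log 2 + Real.log (1 + Real.exp (-s) * B) + s * (C n).expDistortion p f ε := by
    intro s n hn
    have hn' : (0 : ℝ) < n := Nat.cast_pos.2 hn
    have hK1 : 0 < 1 + Real.exp (-s) * B := by positivity
    have h := sum_log_le_of_code (fun x => (p x).toReal) a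
      (fun x z => Real.exp (-s * maxDistortion f ε x z)) hpr hp1 ha (fun _ _ => Real.exp_pos _)
      (K := 1 + Real.exp (-s) * B) (fun z => by
        refine le_trans ?_ (add_le_add_left (hKKT z) _)
        rw [hB, Finset.mul_sum, ← Finset.sum_add_distrib]
        refine Finset.sum_le_sum fun x _ => ?_
        have hd : Real.exp (-s * maxDistortion f ε x z) ≤
            (1 - maxDistortion f ε x z) + Real.exp (-s) := by
          unfold maxDistortion
          split_ifs
          · simp
          · simpa using (Real.exp_pos _).le
        calc _ ≤ (p x).toReal * (((1 - maxDistortion f ε x z) + Real.exp (-s)) / a x) := by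
              have := ha x
              have := hpr x
              gcongr
          _ = _ := by ring) (C n).enc (C n).dec
    have hM : (1 : ℝ) ≤ numMessages n R := by exact_mod_cast one_le_numMessages hR0
    have hMle : (numMessages n R : ℝ) ≤ (2 : ℝ) ^ ((n : ℝ) * R) := Nat.floor_le (by positivity)
    have hlogM : Real.log (numMessages n R) ≤ n * R * Real.log 2 := by
      rw [← Real.log_rpow two_pos]
      exact Real.log_le_log (by linarith) hMle
    rw [Fintype.card_fin, Real.log_mul (by linarith) (by positivity), Real.log_pow] at h
    have hexp : ∀ x : Fin n → X, Real.log (∏ t, Real.exp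
        (-s * maxDistortion f ε (x t) ((C n).dec ((C n).enc x) t)) / a (x t)) =
        -s * (∑ t, maxDistortion f ε (x t) ((C n).dec ((C n).enc x) t)) +
          ∑ t, -Real.log (a (x t)) := fun x => by
      rw [Real.log_prod fun t _ => (div_pos (Real.exp_pos _) (ha _)).ne', Finset.mul_sum,
        ← Finset.sum_add_distrib]
      refine Finset.sum_congr rfl fun t _ => ?_
      rw [Real.log_div (Real.exp_pos _).ne' (ha _).ne', Real.log_exp, sub_eq_add_neg]
    have hD : n * (C n).expDistortion p f ε = ∑ x : Fin n → X, (∏ s, (p (x s)).toReal) *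
        ∑ t, maxDistortion f ε (x t) ((C n).dec ((C n).enc x) t) := by
      rw [expDistortion_eq, ← mul_assoc, mul_one_div_cancel hn'.ne', one_mul, Finset.sum_comm]
      simp_rw [Finset.mul_sum]
    have hLn := sum_prod_mul_sum_eq (fun x => (p x).toReal) (fun x => -Real.log (a x)) hp1 n
    have hsplit : ∑ x : Fin n → X, (∏ s, (p (x s)).toReal) * Real.log (∏ t, Real.exp
        (-s * maxDistortion f ε (x t) ((C n).dec ((C n).enc x) t)) / a (x t)) =
        -s * (n * (C n).expDistortion p f ε) + n * L := by
      rw [hD, ← hLn, Finset.mul_sum, ← Finset.sum_add_distrib]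
      refine Finset.sum_congr rfl fun x _ => ?_
      rw [hexp]
      ring
    rw [hsplit] at h
    refine le_of_mul_le_mul_left ?_ hn'
    linarith
  have key2 : ∀ s : ℝ, L ≤ R * Real.log 2 + Real.log (1 + Real.exp (-s) * B) := fun s => by
    refine ge_of_tendsto (x := atTop) ?_ ((eventually_gt_atTop 0).mono fun n hn => key s n hn)
    simpa using (hC.const_mul s).const_add (R * Real.log 2 + Real.log (1 + Real.exp (-s) * B))
  refine ge_of_tendsto' (x := atTop) ?_ key2
  have h1 : Tendsto (fun s : ℝ => 1 + Real.exp (-s) * B) atTop (𝓝 1) := by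
    simpa using (Real.tendsto_exp_neg_atTop_nhds_zero.mul_const B).const_add 1
  simpa using (h1.log one_ne_zero).const_add (R * Real.log 2)

/-! ### Achievability -/

/-- Random covering: some `M` sets leave uncovered at most the mass that `M` independent random
sets of law `Q` leave uncovered on average. -/
theorem exists_covering_codebook {Y W : Type*} [Fintype Y] [Fintype W] (Q : W → ℝ)
    (hQ : Q ∈ stdSimplex ℝ W) (cov : W → Y → Prop)
    [∀ w, DecidablePred (cov w)] (M : ℕ) (v : Y → ℝ) (hv : ∀ y, 0 ≤ v y) :
    ∃ C : Fin M → W, ∑ y, v y * (if ∃ k, cov (C k) y then 0 else 1) ≤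
      ∑ y, v y * (1 - ∑ w, Q w * if cov w y then 1 else 0) ^ M := by
  set A : Y → ℝ := fun y => ∑ w, Q w * if cov w y then 1 else 0 with hA
  have hA1 : ∀ y, 0 ≤ 1 - A y := fun y => by
    rw [sub_nonneg, ← hQ.2]
    refine Finset.sum_le_sum fun w _ => ?_
    split_ifs <;> simp [hQ.1 w]
  induction M generalizing v with
  | zero => exact ⟨Fin.elim0, by simp⟩
  | succ M ih =>
    -- The sets are chosen one at a time: the right side is the `Q`-average of the left, so some `w`
    -- does at least as well. The mass that `w` leaves uncovered is then passed to the induction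
    -- hypothesis.
    obtain ⟨w, hw⟩ : ∃ w, ∑ y, v y * (1 - A y) ^ M * (if cov w y then 0 else 1) ≤
        ∑ y, v y * (1 - A y) ^ (M + 1) := by
      by_contra! h
      obtain ⟨w₀, hw₀⟩ : ∃ w, 0 < Q w := by
        by_contra! h0
        have := Finset.sum_nonpos fun w (_ : w ∈ Finset.univ) => h0 w
        linarith [hQ.2]
      have hlt := Finset.sum_lt_sum (s := Finset.univ)
        (fun w _ => mul_le_mul_of_nonneg_left (h w).le (hQ.1 w))
        ⟨w₀, Finset.mem_univ _, mul_lt_mul_of_pos_left (h w₀) hw₀⟩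
      rw [← Finset.sum_mul, hQ.2, one_mul] at hlt
      refine hlt.ne ?_
      simp_rw [Finset.mul_sum]
      rw [Finset.sum_comm]
      refine Finset.sum_congr rfl fun y _ => ?_
      have : 1 - A y = ∑ w, Q w * if cov w y then 0 else 1 := by
        rw [sub_eq_iff_eq_add, ← Finset.sum_add_distrib]
        refine hQ.2.symm.trans (Finset.sum_congr rfl fun w _ => ?_)
        split_ifs <;> simp
      rw [pow_succ, ← mul_assoc]
      nth_rw 2 [this]
      rw [Finset.mul_sum]
      exact Finset.sum_congr rfl fun w _ => by ring
    obtain ⟨C, hC⟩ := ih (fun y => v y * if cov w y then 0 else 1)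
      fun y => mul_nonneg (hv y) (by split_ifs <;> norm_num)
    refine ⟨Fin.cons w C, ?_⟩
    calc _ = ∑ y, v y * (if cov w y then 0 else 1) * (if ∃ k, cov (C k) y then 0 else 1) := by
          refine Finset.sum_congr rfl fun y _ => ?_
          simp only [Fin.exists_fin_succ, Fin.cons_zero, Fin.cons_succ]
          by_cases h1 : cov w y <;> simp [h1]
      _ ≤ _ := hC
      _ = ∑ y, v y * (1 - A y) ^ M * (if cov w y then 0 else 1) :=
          Finset.sum_congr rfl fun y _ => by ring
      _ ≤ _ := hw

/-- Chernoff exponent: the moment generating function is 1 at l = 0 and its derivative there is the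
negative mean of c. -/
theorem exists_sum_mul_exp_lt_one {X : Type*} [Fintype X] (p c : X → ℝ) (hp1 : ∑ x, p x = 1)
    (hc : ∑ x, p x * c x < 0) : ∃ l ∈ Set.Ioo (0 : ℝ) 1, ∑ x, p x * Real.exp (l * c x) < 1 := by
  by_contra! h
  have hd : HasDerivAt (fun l : ℝ => -∑ x, p x * Real.exp (l * c x)) (-∑ x, p x * c x) 0 := by
    refine (HasDerivAt.fun_sum fun x _ => HasDerivAt.const_mul _ ?_).neg
    simpa using ((hasDerivAt_id (0 : ℝ)).mul_const (c x)).exp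
  have := deriv_nonpos_of_forall_Ioo_le hd fun t ht => by simpa [hp1] using h t ht
  linarith

/-- The probability of missing a set of probability `∏ t, a t` in `M` trials. -/
theorem one_sub_prod_pow_le {n M : ℕ} (a : Fin n → ℝ) (ha : ∀ t, 0 < a t) (ha1 : ∀ t, a t ≤ 1)
    {l r : ℝ} (hl : l ∈ Set.Ioo (0 : ℝ) 1) (hM : 0 < M)
    (hr : n * r ≤ Real.log M + Real.log 2) :
    (1 - ∏ t, a t) ^ M ≤
      Real.exp (l * Real.log 2) * ∏ t, Real.exp (l * (-Real.log (a t) - r)) := by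
  have hA : 0 < ∏ t, a t := Finset.prod_pos fun t _ => ha t
  have hA1 : ∏ t, a t ≤ 1 := Finset.prod_le_one (fun t _ => (ha t).le) fun t _ => ha1 t
  have hM' : (0 : ℝ) < M := Nat.cast_pos.2 hM
  have hu : 0 < M * ∏ t, a t := mul_pos hM' hA
  calc (1 - ∏ t, a t) ^ M ≤ Real.exp (-∏ t, a t) ^ M :=
        pow_le_pow_left₀ (sub_nonneg.2 hA1) (Real.one_sub_le_exp_neg _) _
    _ = Real.exp (-(M * ∏ t, a t)) := by rw [← Real.exp_nat_mul, mul_neg]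
    _ ≤ Real.exp (-(l * Real.log (M * ∏ t, a t))) := by
        refine Real.exp_le_exp.2 (neg_le_neg ?_)
        -- With u = M ∏ a(t) and 0 < l < 1, l log u ≤ l (u - 1) ≤ u.
        nlinarith [Real.log_le_sub_one_of_pos hu, hl.1, hl.2]
    _ ≤ Real.exp (l * Real.log 2) * ∏ t, Real.exp (l * (-Real.log (a t) - r)) := by
        rw [← Real.exp_sum, ← Real.exp_add, Real.exp_le_exp, Real.log_mul hM'.ne' hA.ne',
          Real.log_prod fun t _ => (ha t).ne', ← Finset.mul_sum, Finset.sum_sub_distrib,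
          Finset.sum_neg_distrib, Finset.sum_const, Finset.card_univ, Fintype.card_fin,
          nsmul_eq_mul]
        nlinarith [hl.1]

/-- Rounding down loses at most a factor 2, since there is at least one message. -/
theorem log_numMessages_ge {n : ℕ} {R : ℝ} (hR : 0 ≤ R) :
    n * (R * Real.log 2) ≤ Real.log (numMessages n R) + Real.log 2 := by
  have h1 : (1 : ℝ) ≤ numMessages n R := by exact_mod_cast one_le_numMessages hR
  have h2 : (2 : ℝ) ^ ((n : ℝ) * R) < numMessages n R + 1 := Nat.lt_floor_add_one _
  rw [← mul_assoc, ← Real.log_rpow two_pos, ← Real.log_mul (by linarith) two_ne_zero]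
  exact Real.log_le_log (by positivity) (by linarith)

theorem expDistortion_le_uncovered {X Z : Type*} [Fintype X] [MeasurableSpace X]
    [DiscreteMeasurableSpace X] [MetricSpace Z] {n : ℕ} {R : ℝ} (C : Code X Z n R) (p : PMF X)
    (f : X → Z) (ε : ℝ) (cov : (Fin n → X) → Prop)
    [DecidablePred cov]
    (h : ∀ x, cov x → ∀ t, maxDistortion f ε (x t) (C.dec (C.enc x) t) = 0) :
    C.expDistortion p f ε ≤ ∑ x, (∏ s, (p (x s)).toReal) * if cov x then 0 else 1 := by
  set S := ∑ x, (∏ s, (p (x s)).toReal) * if cov x then 0 else (1 : ℝ)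
  have hS : 0 ≤ S := Finset.sum_nonneg fun x _ => mul_nonneg
    (Finset.prod_nonneg fun _ _ => ENNReal.toReal_nonneg) (by split_ifs <;> norm_num)
  rw [expDistortion_eq]
  calc _ ≤ (1 / (n : ℝ)) * ∑ t : Fin n, S := by
        refine mul_le_mul_of_nonneg_left (Finset.sum_le_sum fun t _ => Finset.sum_le_sum fun x _ =>
          mul_le_mul_of_nonneg_left ?_ (Finset.prod_nonneg fun _ _ => ENNReal.toReal_nonneg))
          (by positivity)
        split_ifs with hx
        · exact (h x hx t).le
        · unfold maxDistortion
          split_ifs <;> norm_num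
    _ = (1 / (n : ℝ)) * n * S := by simp [mul_assoc]
    -- For n = 0 the convention 1 / 0 = 0 makes the factor 0 rather than 1.
    _ ≤ S := mul_le_of_le_one_left hS (by
        rcases eq_or_ne (n : ℝ) 0 with h0 | h0 <;> simp [h0])

open Classical in
-- A random codeword from q^n covers the source word x with probability ∏ a(x_t). The bound on the
-- probability that all codewords miss x is a product over letters, so its average is a constant
-- times g^n, and the rate condition makes g < 1 for a suitable l.
theorem achievable_of_lt {X Z ι : Type*} [Fintype X] [MeasurableSpace X]
    [DiscreteMeasurableSpace X] [MetricSpace Z] [Fintype ι] (p : PMF X) (f : X → Z) (ε : ℝ)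
    (w : ι → Set X) (z : ι → Z) (hz : ∀ i, ∀ x ∈ w i, dist (f x) (z i) ≤ ε)
    (q : ι → ℝ) (hq : q ∈ stdSimplex ℝ ι)
    (ha : ∀ x, 0 < ∑ i, q i * if x ∈ w i then 1 else 0) {R : ℝ} (hR0 : 0 ≤ R)
    (hR : ∑ x, (p x).toReal * (-Real.log (∑ i, q i * if x ∈ w i then 1 else 0)) <
      R * Real.log 2) :
    Achievable p f ε R := by
  set a : X → ℝ := fun x => ∑ i, q i * if x ∈ w i then 1 else 0 with hadef
  have ha1 : ∀ x, a x ≤ 1 := fun x => by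
    rw [← hq.2]
    refine Finset.sum_le_sum fun i _ => ?_
    split_ifs <;> simp [hq.1 i]
  have hp1 := sum_toReal_eq_one p
  obtain ⟨l, hl, hlt⟩ := exists_sum_mul_exp_lt_one (fun x => (p x).toReal)
    (fun x => -Real.log (a x) - R * Real.log 2) hp1 (by
      simp_rw [mul_sub]
      rw [Finset.sum_sub_distrib, ← Finset.sum_mul, hp1, one_mul]
      linarith)
  set g := ∑ x, (p x).toReal * Real.exp (l * (-Real.log (a x) - R * Real.log 2)) with hg
  have hg0 : 0 ≤ g := Finset.sum_nonneg fun x _ =>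
    mul_nonneg ENNReal.toReal_nonneg (Real.exp_pos _).le
  have hcode : ∀ n, ∃ C : Code X Z n R,
      C.expDistortion p f ε ≤ Real.exp (l * Real.log 2) * g ^ n := fun n => by
    have hQ : (fun c : Fin n → ι => ∏ t, q (c t)) ∈ stdSimplex ℝ (Fin n → ι) :=
      ⟨fun c => Finset.prod_nonneg fun t _ => hq.1 _, by rw [← Fintype.sum_pow, hq.2, one_pow]⟩
    obtain ⟨B, hB⟩ := exists_covering_codebook _ hQ
      (fun c (x : Fin n → X) => ∀ t, x t ∈ w (c t)) (numMessages n R)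
      (fun x => ∏ s, (p (x s)).toReal) fun x => Finset.prod_nonneg fun _ _ => ENNReal.toReal_nonneg
    have hMpos : 0 < numMessages n R := one_le_numMessages hR0
    let enc : (Fin n → X) → Fin (numMessages n R) := fun x =>
      if h : ∃ k, ∀ t, x t ∈ w (B k t) then h.choose else ⟨0, hMpos⟩
    refine ⟨⟨enc, fun k t => z (B k t)⟩, ?_⟩
    refine (expDistortion_le_uncovered _ p f ε (fun x => ∃ k, ∀ t, x t ∈ w (B k t))
      fun x hx t => ?_).trans (hB.trans ?_)
    · have : x t ∈ w (B (enc x) t) := by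
        simp only [enc, dif_pos hx]
        exact hx.choose_spec t
      exact if_neg (not_lt.2 (hz _ _ this))
    · have hprod : ∀ x : Fin n → X,
          ∑ c : Fin n → ι, (∏ t, q (c t)) * (if ∀ t, x t ∈ w (c t) then 1 else 0) =
            ∏ t, a (x t) := fun x => by
        rw [hadef, Fintype.prod_sum]
        refine Finset.sum_congr rfl fun c _ => ?_
        rw [Finset.prod_mul_distrib, Finset.prod_ite_zero]
        simp
      rw [hg, Fintype.sum_pow, Finset.mul_sum]
      refine Finset.sum_le_sum fun x _ => ?_
      rw [hprod x, Finset.prod_mul_distrib, mul_left_comm]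
      exact mul_le_mul_of_nonneg_left (one_sub_prod_pow_le _ (fun t => ha (x t))
        (fun t => ha1 (x t)) hl hMpos (log_numMessages_ge hR0))
        (Finset.prod_nonneg fun _ _ => ENNReal.toReal_nonneg)
  choose C hC using hcode
  refine ⟨hR0, C, squeeze_zero (fun n => ?_) hC ?_⟩
  · rw [expDistortion_eq]
    exact mul_nonneg (by positivity) (Finset.sum_nonneg fun t _ => Finset.sum_nonneg fun x _ =>
      mul_nonneg (Finset.prod_nonneg fun _ _ => ENNReal.toReal_nonneg) (maxDistortion_nonneg ..))
  · simpa using (tendsto_pow_atTop_nhds_zero_of_lt_one hg0 hlt).const_mul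
      (Real.exp (l * Real.log 2))

/-! ### Mutual information -/

open InformationTheory in
/-- Gibbs' inequality against the density `h` on a set `S` carrying `μ`. -/
theorem ofReal_integral_log_le_klDiv {Ω : Type*} [MeasurableSpace Ω] (μ ν : Measure Ω)
    [IsProbabilityMeasure μ] [IsProbabilityMeasure ν] {S : Set Ω} (hS : MeasurableSet S)
    (hμS : μ Sᶜ = 0) {h : Ω → ℝ} (hpos : ∀ ω, 0 < h ω)
    (hlog : Integrable (fun ω => Real.log (h ω)) μ) (hint : IntegrableOn h S ν)
    (hle : ∫ ω in S, h ω ∂ν ≤ 1) :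
    ENNReal.ofReal (∫ ω, Real.log (h ω) ∂μ) ≤ klDiv μ ν := by
  by_cases hac : μ ≪ ν
  swap; · simp [klDiv_of_not_ac hac]
  by_cases hllr : Integrable (llr μ ν) μ
  swap; · simp [klDiv_of_not_integrable hllr]
  rw [klDiv_eq_integral_klFun, if_pos ⟨hac, hllr⟩]
  refine ENNReal.ofReal_le_ofReal ?_
  set g : Ω → ℝ := fun ω => (μ.rnDeriv ν ω).toReal with hg
  have hi1 : Integrable (fun ω => g ω * Real.log (h ω)) ν :=
    (integrable_rnDeriv_smul_iff hac).2 hlog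
  have hi2 : Integrable (S.indicator h) ν := (integrable_indicator_iff hS).2 hint
  have hi3 : Integrable (fun ω => 1 - S.indicator h ω) ν := (integrable_const _).sub hi2
  -- Off `S` the density vanishes and the pointwise comparison below becomes the equality 1 = `klFun
  -- 0`.
  have hg0 : ∀ᵐ ω ∂ν, ω ∈ Sᶜ → g ω = 0 := by
    have h0 : ∫⁻ ω in Sᶜ, μ.rnDeriv ν ω ∂ν = 0 := by
      rw [Measure.setLIntegral_rnDeriv' hac hS.compl, hμS]
    rw [lintegral_eq_zero_iff (Measure.measurable_rnDeriv μ ν), EventuallyEq,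
      ae_restrict_iff' hS.compl] at h0
    filter_upwards [h0] with ω hω hωS
    simp [hg, hω hωS]
  calc ∫ ω, Real.log (h ω) ∂μ ≤ ∫ ω, Real.log (h ω) ∂μ + (1 - ∫ ω in S, h ω ∂ν) := by linarith
    _ = ∫ ω, (g ω * Real.log (h ω) + (1 - S.indicator h ω)) ∂ν := by
        rw [integral_add hi1 hi3,
          integral_sub (integrable_const _) hi2, integral_indicator hS]
        congr 1
        · exact (integral_rnDeriv_smul hac).symm
        · simp
    -- On `S` this is g log (h / g) ≤ h - g.
    _ ≤ ∫ ω, klFun (g ω) ∂ν := by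
        refine integral_mono_ae (hi1.add hi3)
          ((integrable_klFun_rnDeriv_iff hac).2 hllr) ?_
        filter_upwards [hg0] with ω hω
        rw [klFun_apply]
        by_cases hωS : ω ∈ S
        · rw [Set.indicator_of_mem hωS]
          have hgn : 0 ≤ g ω := ENNReal.toReal_nonneg
          rcases hgn.eq_or_lt with h0 | h0
          · rw [← h0]
            simp [(hpos ω).le]
          · have h1 := Real.log_le_sub_one_of_pos (div_pos (hpos ω) h0)
            rw [Real.log_div (hpos ω).ne' h0.ne'] at h1
            have h2 := mul_le_mul_of_nonneg_left h1 h0.le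
            rw [mul_sub, mul_sub, mul_div_cancel₀ _ h0.ne', mul_one] at h2
            linarith
        · simp [Set.indicator_of_notMem hωS, hω hωS]

theorem measurableSet_graph {X V : Type*} [Finite X] [MeasurableSpace X]
    [DiscreteMeasurableSpace X] [MeasurableSpace V] {A : X → Set V}
    (hA : ∀ x, MeasurableSet (A x)) : MeasurableSet {q : X × V | q.2 ∈ A q.1} := by
  have : {q : X × V | q.2 ∈ A q.1} = ⋃ x, {x} ×ˢ A x := by
    ext ⟨x, v⟩
    simp
  rw [this]
  exact .iUnion fun x => (measurableSet_singleton x).prod (hA x)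

/-- Gibbs' inequality with density 1/a(x) on the graph of `A`, which carries the joint law.
Integrating over x first, `hKKT` bounds its mass under the product of the marginals by 1. -/
theorem ofReal_sum_log_le_klDiv {X V : Type*} [Fintype X] [MeasurableSpace X]
    [DiscreteMeasurableSpace X] [MeasurableSpace V] (p : PMF X) (κ : Kernel X V)
    [IsMarkovKernel κ] {A : X → Set V} (hA : ∀ x, MeasurableSet (A x))
    (hκ : ∀ x, ∀ᵐ v ∂κ x, v ∈ A x) {a : X → ℝ} (ha : ∀ x, 0 < a x)
    (hKKT : ∀ᵐ v ∂(κ ∘ₘ p.toMeasure),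
      ∑ x, (p x).toReal * (A x).indicator (fun _ => (a x)⁻¹) v ≤ 1) :
    ENNReal.ofReal (∑ x, (p x).toReal * (-Real.log (a x))) ≤
      InformationTheory.klDiv (p.toMeasure ⊗ₘ κ) (p.toMeasure.prod (κ ∘ₘ p.toMeasure)) := by
  have hS := measurableSet_graph hA
  have hm : ∀ φ : X → ℝ, Integrable (fun q : X × V => φ q.1)
      (p.toMeasure.prod (κ ∘ₘ p.toMeasure)) := fun φ =>
    (Integrable.of_finite (f := φ) (μ := p.toMeasure)).comp_fst _
  have h2 : Integrable (fun x => Real.log (a x)⁻¹) (p.toMeasure ⊗ₘ κ).fst := .of_finite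
  have hlogint : ∫ q : X × V, Real.log (a q.1)⁻¹ ∂(p.toMeasure ⊗ₘ κ) =
      ∑ x, (p x).toReal * (-Real.log (a x)) := by
    have h1 : ∫ q : X × V, Real.log (a q.1)⁻¹ ∂(p.toMeasure ⊗ₘ κ) =
        ∫ x, Real.log (a x)⁻¹ ∂(p.toMeasure ⊗ₘ κ).fst :=
      (integral_map measurable_fst.aemeasurable h2.aestronglyMeasurable).symm
    rw [h1, Measure.fst_compProd, PMF.integral_eq_sum]
    simp [Real.log_inv]
  rw [← hlogint]
  refine ofReal_integral_log_le_klDiv _ _ hS ?_ (fun q => inv_pos.2 (ha q.1)) ?_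
    (hm fun x => (a x)⁻¹).integrableOn ?_
  · rw [measure_eq_zero_iff_ae_notMem, Measure.ae_compProd_iff hS.compl.compl]
    exact ae_of_all _ fun x => (hκ x).mono fun v hv => by simpa using hv
  · exact h2.comp_measurable measurable_fst
  · rw [← integral_indicator hS, integral_prod_symm _
      ((integrable_indicator_iff hS).2 (hm fun x => (a x)⁻¹).integrableOn)]
    have h3 : ∀ v, ∫ x, {q : X × V | q.2 ∈ A q.1}.indicator (fun q => (a q.1)⁻¹) (x, v)
        ∂p.toMeasure = ∑ x, (p x).toReal * (A x).indicator (fun _ => (a x)⁻¹) v := fun v => by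
      rw [PMF.integral_eq_sum]
      rfl
    simp_rw [h3]
    calc _ ≤ ∫ _, (1 : ℝ) ∂(κ ∘ₘ p.toMeasure) := by
          refine integral_mono_ae ?_ (integrable_const _) hKKT
          exact integrable_finsetSum _ fun x _ =>
            ((integrable_const _).indicator (hA x)).const_mul _
      _ = 1 := by simp

/-- The sum in `hKKT` is the density of the output law with respect to `ρ`. A density at most 1 puts
one probability measure below another, which forces equality. -/
theorem comp_cond_eq {X V : Type*} [Fintype X] [MeasurableSpace X]
    [DiscreteMeasurableSpace X] [MeasurableSpace V] (p : PMF X) (ρ : Measure V)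
    [IsProbabilityMeasure ρ] {A : X → Set V} (hA : ∀ x, MeasurableSet (A x))
    (κ : Kernel X V) [IsMarkovKernel κ] (hκ : ∀ x, κ x = ρ[|A x])
    (hKKT : ∀ᵐ v ∂ρ, ∑ x, p x * (A x).indicator (fun _ => (ρ (A x))⁻¹) v ≤ 1) :
    κ ∘ₘ p.toMeasure = ρ := by
  refine Measure.eq_of_le_of_isProbabilityMeasure (Measure.le_iff.2 fun B hB => ?_)
  rw [Measure.bind_apply hB κ.aemeasurable, lintegral_fintype]
  calc ∑ x, κ x B * p.toMeasure {x}
      = ∑ x, ∫⁻ v in B, p x * (A x).indicator (fun _ => (ρ (A x))⁻¹) v ∂ρ := by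
        refine Finset.sum_congr rfl fun x _ => ?_
        rw [lintegral_const_mul _ (measurable_const.indicator (hA x)),
          lintegral_indicator_const (hA x), Measure.restrict_apply (hA x), hκ,
          cond_apply (hA x), p.toMeasure_apply_singleton _ (measurableSet_singleton _), mul_comm]
    _ = ∫⁻ v in B, ∑ x, p x * (A x).indicator (fun _ => (ρ (A x))⁻¹) v ∂ρ :=
        (lintegral_finsetSum _ fun x _ =>
          (measurable_const.indicator (hA x)).const_mul _).symm
    _ ≤ ∫⁻ v in B, 1 ∂ρ := lintegral_mono_ae (ae_restrict_of_ae hKKT)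
    _ = ρ B := by simp

open InformationTheory in
-- Conditioning gives the joint law the density 1/ρ(A x) on the graph of `A`, so the log-likelihood
-- ratio depends on x alone.
theorem klDiv_cond_le {X V : Type*} [Fintype X] [MeasurableSpace X]
    [DiscreteMeasurableSpace X] [MeasurableSpace V] (p : PMF X) (ρ : Measure V)
    [IsProbabilityMeasure ρ] {A : X → Set V} (hA : ∀ x, MeasurableSet (A x))
    (κ : Kernel X V) [IsMarkovKernel κ] (hκ : ∀ x, κ x = ρ[|A x]) :
    klDiv (p.toMeasure ⊗ₘ κ) (p.toMeasure.prod ρ) ≤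
      ENNReal.ofReal (∑ x, (p x).toReal * (-Real.log (ρ.real (A x)))) := by
  have hS := measurableSet_graph hA
  set S : Set (X × V) := {q | q.2 ∈ A q.1} with hSdef
  set h : X × V → ℝ≥0∞ := S.indicator fun q => (ρ (A q.1))⁻¹ with hh
  have hhm : Measurable h :=
    ((measurable_of_finite fun x => (ρ (A x))⁻¹).comp measurable_fst).indicator hS
  have hμ : p.toMeasure ⊗ₘ κ = (p.toMeasure.prod ρ).withDensity h := by
    ext T hT
    rw [withDensity_apply _ hT, ← lintegral_indicator hT, lintegral_prod _
      (hhm.indicator hT).aemeasurable, Measure.compProd_apply hT]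
    refine lintegral_congr fun x => ?_
    have hTx : MeasurableSet (Prod.mk x ⁻¹' T) := measurable_prodMk_left hT
    have h1 : ∀ v, T.indicator h (x, v) =
        (A x ∩ Prod.mk x ⁻¹' T).indicator (fun _ => (ρ (A x))⁻¹) v := fun v => by
      rw [hh, Set.indicator_indicator, Set.inter_comm]
      rfl
    simp_rw [h1]
    rw [lintegral_indicator_const ((hA x).inter hTx), hκ, cond_apply (hA x)]
  have hac : p.toMeasure ⊗ₘ κ ≪ p.toMeasure.prod ρ := by
    rw [hμ]
    exact withDensity_absolutelyContinuous _ _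
  have hmem : ∀ᵐ q ∂(p.toMeasure ⊗ₘ κ), q ∈ S := by
    refine Measure.ae_compProd_of_ae_ae hS (ae_of_all _ fun x => ?_)
    rw [hκ]
    exact ae_cond_mem (hA x)
  have hllr : llr (p.toMeasure ⊗ₘ κ) (p.toMeasure.prod ρ) =ᵐ[p.toMeasure ⊗ₘ κ]
      fun q => -Real.log (ρ.real (A q.1)) := by
    have h2 : (p.toMeasure ⊗ₘ κ).rnDeriv (p.toMeasure.prod ρ) =ᵐ[p.toMeasure.prod ρ] h := by
      rw [hμ]
      exact Measure.rnDeriv_withDensity _ hhm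
    filter_upwards [hac.ae_le h2, hmem] with q hq hqS
    rw [llr, hq, hh, Set.indicator_of_mem hqS, ENNReal.toReal_inv, Real.log_inv, measureReal_def]
  have hint : Integrable (fun x => -Real.log (ρ.real (A x))) (p.toMeasure ⊗ₘ κ).fst := .of_finite
  have h1 : ∫ q : X × V, -Real.log (ρ.real (A q.1)) ∂(p.toMeasure ⊗ₘ κ) =
      ∫ x, -Real.log (ρ.real (A x)) ∂(p.toMeasure ⊗ₘ κ).fst :=
    (integral_map measurable_fst.aemeasurable hint.aestronglyMeasurable).symm
  rw [klDiv_of_ac_of_integrable hac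
    ((integrable_congr hllr).2 (hint.comp_measurable measurable_fst)), integral_congr_ae hllr, h1,
    Measure.fst_compProd, PMF.integral_eq_sum]
  simp

theorem mutualInfo_map_le {X V V' : Type*} [MeasurableSpace X] [MeasurableSpace V]
    [MeasurableSpace V'] (p : PMF X) (κ : Kernel X V) [IsMarkovKernel κ] {c : V → V'}
    (hc : Measurable c) : mutualInfo p (κ.map c) ≤ mutualInfo p κ := by
  have h1 : p.toMeasure ⊗ₘ κ.map c = (p.toMeasure ⊗ₘ κ).map (Prod.map id c) := by
    have := Kernel.IsMarkovKernel.map κ hc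
    ext s hs
    rw [Measure.map_apply (measurable_id.prodMap hc) hs, Measure.compProd_apply hs,
      Measure.compProd_apply (measurable_id.prodMap hc hs)]
    refine lintegral_congr fun x => ?_
    rw [Kernel.map_apply' κ hc x (measurable_prodMk_left hs)]
    rfl
  have h2 : p.toMeasure.prod (κ.map c ∘ₘ p.toMeasure) =
      (p.toMeasure.prod (κ ∘ₘ p.toMeasure)).map (Prod.map id c) := by
    rw [← Measure.map_comp _ _ hc, ← Measure.map_prod_map _ _ measurable_id hc, Measure.map_id]
  unfold mutualInfo
  rw [h1, h2]
  gcongr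
  exact InformationTheory.klDiv_map_le _ _ (measurable_id.prodMap hc)

/-! ### Maximal hyperedges -/

/-- Any enclosable nonempty set becomes part of a characteristic hypergraph once all singletons are
added to secure the cover. -/
theorem mem_allHyperedges_iff {X Z : Type*} [MetricSpace Z] {p : PMF X} (hp : ∀ x, 0 < p x)
    {f : X → Z} {ε : ℝ} (hε : 0 ≤ ε) {w : Set X} :
    w ∈ allHyperedges p f ε ↔ w.Nonempty ∧ ∃ c, ∀ x ∈ w, dist (f x) c ≤ ε := by
  constructor
  · rintro ⟨E, hE, hw⟩
    obtain ⟨c, r, -, hr, h⟩ := hE.sec w hw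
    exact ⟨hE.nonempty w hw, c, fun x hx => (h _ ⟨x, hx, hp x, rfl⟩).trans hr⟩
  · rintro ⟨hw, c, hc⟩
    refine ⟨insert w (Set.range fun x => {x}), ⟨?_, ?_, ?_⟩, Set.mem_insert _ _⟩
    · rintro _ (rfl | ⟨x, rfl⟩)
      exacts [hw, Set.singleton_nonempty x]
    · rintro _ (rfl | ⟨x, rfl⟩)
      · refine ⟨c, ε, hε, le_rfl, ?_⟩
        rintro _ ⟨x, hx, -, rfl⟩
        exact hc x hx
      · refine ⟨f x, ε, hε, le_rfl, ?_⟩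
        rintro _ ⟨y, rfl, -, rfl⟩
        simpa using hε
    · exact fun x => ⟨{x}, Or.inr ⟨x, rfl⟩, rfl⟩

theorem exists_maximalHyperedge_superset {X Z : Type*} [Finite X] [MetricSpace Z] {p : PMF X}
    {f : X → Z} {ε : ℝ} {w : Set X} (hw : w ∈ allHyperedges p f ε) :
    ∃ w' ∈ maximalHyperedges p f ε, w ⊆ w' := by
  obtain ⟨w', hle, hmax⟩ := (Set.toFinite (allHyperedges p f ε)).exists_le_maximal hw
  exact ⟨w', ⟨hmax.prop, fun ⟨v, hv, hlt⟩ => hlt.2 (hmax.le_of_ge hv hlt.1)⟩, hle⟩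

theorem measurable_maxDistortion {X Z : Type*} [Finite X] [MeasurableSpace X]
    [DiscreteMeasurableSpace X] [MetricSpace Z] [MeasurableSpace Z] [BorelSpace Z] (f : X → Z)
    (ε : ℝ) : Measurable fun q : X × Z => maxDistortion f ε q.1 q.2 :=
  Measurable.ite (measurableSet_graph (A := fun x => {z | ε < dist (f x) z}) fun _ =>
    (isOpen_lt continuous_const (continuous_const.dist continuous_id)).measurableSet)
    measurable_const measurable_const

theorem maxDistortion_eq_zero_iff {X Z : Type*} [MetricSpace Z] {f : X → Z} {ε : ℝ} {x : X}
    {z : Z} : maxDistortion f ε x z = 0 ↔ z ∈ Metric.closedBall (f x) ε := by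
  unfold maxDistortion
  rw [Metric.mem_closedBall, dist_comm z, ← not_lt]
  split_ifs with h <;> simp [h]

theorem channelDistortion_eq_zero_iff {X Z : Type*} [Fintype X] [MeasurableSpace X]
    [DiscreteMeasurableSpace X] [MetricSpace Z] [MeasurableSpace Z] [BorelSpace Z] (p : PMF X)
    (hp : ∀ x, 0 < p x) (f : X → Z) (ε : ℝ) (κ : Kernel X Z) [IsMarkovKernel κ] :
    channelDistortion p κ f ε = 0 ↔ ∀ x, ∀ᵐ z ∂κ x, z ∈ Metric.closedBall (f x) ε := by
  have hm := measurable_maxDistortion f ε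
  have hae : ∀ P : X → Prop, (∀ᵐ x ∂p.toMeasure, P x) ↔ ∀ x, P x := fun P => by
    refine ⟨fun h x => ?_, ae_of_all _⟩
    by_contra hx
    have h0 := measure_mono_null (Set.singleton_subset_iff.2 hx) h
    rw [p.toMeasure_apply_singleton _ (measurableSet_singleton _)] at h0
    exact (hp x).ne' h0
  rw [channelDistortion, integral_eq_zero_iff_of_nonneg (fun _ => maxDistortion_nonneg ..)]
  · simp only [EventuallyEq, Pi.zero_apply]
    rw [Measure.ae_compProd_iff (measurableSet_eq_fun hm measurable_const), hae]
    simp only [maxDistortion_eq_zero_iff]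
  · refine Integrable.of_bound hm.aestronglyMeasurable 1 (ae_of_all _ fun q => ?_)
    unfold maxDistortion
    split_ifs <;> simp

/-- The optimal exponent: a function `a` on the source alphabet that gives the exponent
`∑ x, p x * (-log (a x))`, together with the law `q` on the maximal hyperedges that induces it. -/
theorem exists_optimal_hyperedge_law {X Z : Type*} [Fintype X] [MetricSpace Z] (p : PMF X)
    (hp : ∀ x, 0 < p x) (f : X → Z) (ε : ℝ) (hε : 0 ≤ ε)
    [Fintype (maximalHyperedges p f ε)] [∀ (x : X) (w : Set X), Decidable (x ∈ w)] :
    ∃ q ∈ stdSimplex ℝ (maximalHyperedges p f ε),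
      (∀ x, 0 < ∑ i, q i * if x ∈ i.1 then 1 else 0) ∧
      ∀ w ∈ maximalHyperedges p f ε, ∑ x, (p x).toReal *
        w.indicator (fun x => (∑ i, q i * if x ∈ i.1 then 1 else 0)⁻¹) x ≤ 1 := by
  have hcov : ∀ x, ∃ w ∈ maximalHyperedges p f ε, x ∈ w := fun x => by
    obtain ⟨w, hw, hxw⟩ := exists_maximalHyperedge_superset
      ((mem_allHyperedges_iff (p := p) (f := f) hp hε (w := {x})).2
        ⟨Set.singleton_nonempty x, f x, by simpa using hε⟩)
    exact ⟨w, hw, hxw rfl⟩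
  obtain ⟨x₀, -⟩ := p.support_nonempty
  obtain ⟨w₀, hw₀, -⟩ := hcov x₀
  have : Nonempty (maximalHyperedges p f ε) := ⟨⟨w₀, hw₀⟩⟩
  obtain ⟨q, hq, ha, hK⟩ := exists_optimal_weights (fun x => (p x).toReal)
    (fun x => ENNReal.toReal_pos (hp x).ne' (p.apply_ne_top x))
    (fun (i : maximalHyperedges p f ε) x => if x ∈ i.1 then 1 else 0)
    (fun i x => by split_ifs <;> norm_num)
    (fun x => by
      obtain ⟨w, hw, hx⟩ := hcov x
      exact ⟨⟨w, hw⟩, by simp [hx]⟩)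
  refine ⟨q, hq, ha, fun w hw => ?_⟩
  have h := hK ⟨w, hw⟩
  rw [sum_toReal_eq_one] at h
  refine (Finset.sum_congr rfl fun x _ => ?_).trans_le h
  by_cases hx : x ∈ w <;> simp [hx]

/-- Enlarging the set of letters within ε of z to a maximal hyperedge only increases the sum,
because `b` is nonnegative. -/
theorem sum_indicator_closedBall_le_one {X Z : Type*} [Fintype X] [MetricSpace Z] {p : PMF X}
    (hp : ∀ x, 0 < p x) {f : X → Z} {ε : ℝ} (hε : 0 ≤ ε) {b : X → ℝ} (hb : ∀ x, 0 ≤ b x)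
    (h : ∀ w ∈ maximalHyperedges p f ε, ∑ x, (p x).toReal * w.indicator b x ≤ 1) (z : Z) :
    ∑ x, (p x).toReal * (Metric.closedBall (f x) ε).indicator (fun _ => b x) z ≤ 1 := by
  have hz : ∀ x, (Metric.closedBall (f x) ε).indicator (fun _ => b x) z =
      {x | dist (f x) z ≤ ε}.indicator b x := fun x => by
    simp only [Set.indicator, Metric.mem_closedBall, Set.mem_ofPred_eq, dist_comm z]
  simp_rw [hz]
  rcases Set.eq_empty_or_nonempty {x | dist (f x) z ≤ ε} with h0 | h0
  · simp [h0]
  · obtain ⟨w, hw, hsub⟩ := exists_maximalHyperedge_superset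
      ((mem_allHyperedges_iff hp hε).2 ⟨h0, z, fun x hx => hx⟩)
    refine le_trans (Finset.sum_le_sum fun x _ => ?_) (h w hw)
    exact mul_le_mul_of_nonneg_left (Set.indicator_le_indicator_of_subset hsub hb x)
      ENNReal.toReal_nonneg

/-- The optimal law on the maximal hyperedges induces a test channel `x ↦ ρ[|x ∈ w]` attaining the
exponent. -/
theorem exists_optimal_channel {X : Type*} [Fintype X] [MeasurableSpace X]
    [DiscreteMeasurableSpace X] (p : PMF X) (Γ : Set (Set X)) [Fintype Γ]
    [∀ (x : X) (w : Set X), Decidable (x ∈ w)] (q : Γ → ℝ) (hq : q ∈ stdSimplex ℝ Γ)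
    (ha : ∀ x, 0 < ∑ i, q i * if x ∈ i.1 then 1 else 0)
    (hK : ∀ w ∈ Γ, ∑ x, (p x).toReal *
      w.indicator (fun x => (∑ i, q i * if x ∈ i.1 then 1 else 0)⁻¹) x ≤ 1) :
    ∃ κ : Kernel X (Set X), IsMarkovKernel κ ∧ (∀ x w, κ x {w} ≠ 0 → x ∈ w ∧ w ∈ Γ) ∧
      InformationTheory.klDiv (p.toMeasure ⊗ₘ κ) (p.toMeasure.prod (κ ∘ₘ p.toMeasure)) ≤
        ENNReal.ofReal (∑ x, (p x).toReal *
          (-Real.log (∑ i, q i * if x ∈ i.1 then 1 else 0))) := by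
  set a : X → ℝ := fun x => ∑ i, q i * if x ∈ i.1 then 1 else 0
  set ρ : Measure (Set X) := ∑ i, ENNReal.ofReal (q i) • Measure.dirac i.1 with hρ
  have hms : ∀ S : Set (Set X), MeasurableSet S := fun S => S.toFinite.measurableSet
  have hρS : ∀ S : Set (Set X), ρ S = ∑ i, ENNReal.ofReal (q i) * S.indicator 1 i.1 := fun S => by
    simp [hρ, Measure.finsetSum_apply, Measure.dirac_apply' _ (hms S)]
  have : IsProbabilityMeasure ρ := ⟨by
    rw [hρS]
    simp [← ENNReal.ofReal_sum_of_nonneg fun i _ => hq.1 i, hq.2]⟩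
  have hρA : ∀ x, ρ {w | x ∈ w} = ENNReal.ofReal (a x) := fun x => by
    rw [hρS, ENNReal.ofReal_sum_of_nonneg fun i _ =>
      mul_nonneg (hq.1 i) (by split_ifs <;> norm_num)]
    refine Finset.sum_congr rfl fun i _ => ?_
    by_cases hx : x ∈ i.1 <;> simp [hx]
  have hρΓ : ∀ᵐ w ∂ρ, w ∈ Γ := by
    rw [ae_iff, hρS]
    simp
  let κ : Kernel X (Set X) := ⟨fun x => ρ[|{w | x ∈ w}], measurable_of_finite _⟩
  have hκ : ∀ x, κ x = ρ[|{w | x ∈ w}] := fun x => rfl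
  have hM : IsMarkovKernel κ := ⟨fun x => by
    rw [hκ]
    exact cond_isProbabilityMeasure (by rw [hρA]; exact (ENNReal.ofReal_pos.2 (ha x)).ne')⟩
  refine ⟨κ, hM, fun x w h => ?_, ?_⟩
  · rw [hκ, cond_apply (hms _)] at h
    have h' : ρ ({w | x ∈ w} ∩ {w}) ≠ 0 := fun h0 => h (by rw [h0, mul_zero])
    constructor
    · by_contra hx
      refine h' ?_
      have : {w : Set X | x ∈ w} ∩ {w} = ∅ := Set.inter_singleton_eq_empty.2 hx
      rw [this, measure_empty]
    · by_contra hw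
      refine h' (measure_mono_null ?_ (ae_iff.1 hρΓ))
      rintro _ ⟨-, rfl⟩
      exact hw
  -- By the optimality conditions the output law is `ρ` itself, so the divergence can be computed
  -- against `ρ`.
  · rw [comp_cond_eq p ρ (fun x => hms {w | x ∈ w}) κ hκ]
    · refine (klDiv_cond_le p ρ (fun x => hms {w | x ∈ w}) κ hκ).trans_eq ?_
      congr 1
      refine Finset.sum_congr rfl fun x _ => ?_
      rw [measureReal_def, hρA, ENNReal.toReal_ofReal (ha x).le]
    · filter_upwards [hρΓ] with w hw
      refine le_trans (le_of_eq ?_) (ENNReal.ofReal_le_one.2 (hK w hw))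
      rw [ENNReal.ofReal_sum_of_nonneg fun x _ => mul_nonneg ENNReal.toReal_nonneg
        (Set.indicator_nonneg (fun x _ => inv_nonneg.2 (ha x).le) x)]
      refine Finset.sum_congr rfl fun x _ => ?_
      rw [ENNReal.ofReal_mul ENNReal.toReal_nonneg, ENNReal.ofReal_toReal (p.apply_ne_top x), hρA]
      congr 1
      by_cases hx : x ∈ w
      · rw [Set.indicator_of_mem hx, Set.indicator_of_mem (by exact hx),
          ENNReal.ofReal_inv_of_pos (ha x)]
      · simp [hx]

end FunctionalCompression

/-! ### The rate-distortion function and the two minima. -/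

theorem mainTheorem7 {X Z : Type*} [Fintype X] [MeasurableSpace X] [DiscreteMeasurableSpace X]
    [MetricSpace Z] [MeasurableSpace Z] [BorelSpace Z]
    (p : PMF X) (hp : ∀ x, 0 < p x) (f : X → Z) (ε : ℝ) (hε : 0 ≤ ε) :
    IsLeast {r : ℝ≥0∞ | ∃ κ : Kernel X Z, IsMarkovKernel κ ∧
        FunctionalCompression.channelDistortion p κ f ε = 0 ∧
        r = FunctionalCompression.mutualInfo p κ}
      (FunctionalCompression.rateDistortion p f ε) ∧
    IsLeast {r : ℝ≥0∞ | ∃ κ : Kernel X (Set X), IsMarkovKernel κ ∧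
        (∀ (x : X) (w : Set X), κ x {w} ≠ 0 →
          x ∈ w ∧ w ∈ FunctionalCompression.maximalHyperedges p f ε) ∧
        r = FunctionalCompression.mutualInfo p κ}
      (FunctionalCompression.rateDistortion p f ε) ∧
    (FunctionalCompression.maximalHyperedges p f ε).Finite := by
  classical
  set Γ := FunctionalCompression.maximalHyperedges p f ε
  have hΓfin : Γ.Finite := Set.toFinite Γ
  let _ : Fintype Γ := hΓfin.fintype
  obtain ⟨q, hq, ha, hK⟩ := FunctionalCompression.exists_optimal_hyperedge_law p hp f ε hε
  obtain ⟨κ, hκM, hκsupp, hκle⟩ := FunctionalCompression.exists_optimal_channel p Γ q hq ha hK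
  set a : X → ℝ := fun x => ∑ i, q i * if x ∈ i.1 then 1 else 0
  set L : ℝ := ∑ x, (p x).toReal * (-Real.log (a x))
  have hlog2 : 0 < Real.log 2 := Real.log_pos one_lt_two
  have hL0 : 0 ≤ L := Finset.sum_nonneg fun x _ => mul_nonneg ENNReal.toReal_nonneg
    (neg_nonneg.2 (Real.log_nonpos (ha x).le (by
      rw [← hq.2]
      refine Finset.sum_le_sum fun i _ => ?_
      split_ifs <;> simp [hq.1 i])))
  have hKz := FunctionalCompression.sum_indicator_closedBall_le_one hp hε (fun x => inv_nonneg.2 (ha x).le) hK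
  have hcenter : ∀ i : Γ, ∃ c, ∀ x ∈ i.1, dist (f x) c ≤ ε := fun i =>
    ((FunctionalCompression.mem_allHyperedges_iff hp hε).1 i.2.1).2
  choose z hz using hcenter
  have hrate : FunctionalCompression.rateDistortion p f ε = ENNReal.ofReal L / ENNReal.ofReal (Real.log 2) := by
    rw [← ENNReal.ofReal_div_of_pos hlog2]
    refine le_antisymm (ENNReal.le_of_forall_pos_le_add fun δ hδ _ => ?_) (le_sInf ?_)
    · rw [← ENNReal.ofReal_coe_nnreal, ← ENNReal.ofReal_add (div_nonneg hL0 hlog2.le) (NNReal.coe_nonneg δ)]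
      refine sInf_le ⟨_, FunctionalCompression.achievable_of_lt p f ε (fun i : Γ => i.1) z hz q hq ha
        (add_nonneg (div_nonneg hL0 hlog2.le) (NNReal.coe_nonneg δ)) ?_, rfl⟩
      rw [add_mul, div_mul_cancel₀ _ hlog2.ne']
      exact lt_add_of_pos_right _ (mul_pos hδ hlog2)
    · rintro _ ⟨R, hR, rfl⟩
      refine ENNReal.ofReal_le_ofReal ((div_le_iff₀ hlog2).2
        (FunctionalCompression.le_rate_of_achievable p hp f ε a ha (fun z => ?_) hR))
      refine (Finset.sum_congr rfl fun x _ => ?_).trans_le (hKz z)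
      by_cases hx : z ∈ Metric.closedBall (f x) ε
      · rw [FunctionalCompression.maxDistortion_eq_zero_iff.2 hx, Set.indicator_of_mem hx, sub_zero, one_div]
      · have h1 : FunctionalCompression.maxDistortion f ε x z = 1 := by
          rw [← FunctionalCompression.maxDistortion_eq_zero_iff] at hx
          unfold FunctionalCompression.maxDistortion at hx ⊢
          split_ifs at hx ⊢ <;> simp at hx ⊢
        rw [h1, Set.indicator_of_notMem hx, sub_self, zero_div]
  have hκup : FunctionalCompression.mutualInfo p κ ≤ FunctionalCompression.rateDistortion p f ε := by
    rw [hrate]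
    exact ENNReal.div_le_div_right hκle _
  have hae : ∀ (κ : Kernel X (Set X)), (∀ x w, κ x {w} ≠ 0 → x ∈ w ∧ w ∈ Γ) →
      ∀ x, ∀ᵐ w ∂κ x, x ∈ w ∧ w ∈ Γ := fun κ h x => by
    rw [ae_iff_of_countable]
    exact h x
  have hlowZ : ∀ κ : Kernel X Z, IsMarkovKernel κ → FunctionalCompression.channelDistortion p κ f ε = 0 →
      FunctionalCompression.rateDistortion p f ε ≤ FunctionalCompression.mutualInfo p κ := fun κ _ h0 => by
    rw [hrate]
    exact ENNReal.div_le_div_right (FunctionalCompression.ofReal_sum_log_le_klDiv p κ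
      (fun x => Metric.isClosed_closedBall.measurableSet)
      ((FunctionalCompression.channelDistortion_eq_zero_iff p hp f ε κ).1 h0) ha (ae_of_all _ hKz)) _
  have hlowW : ∀ κ : Kernel X (Set X), IsMarkovKernel κ →
      (∀ x w, κ x {w} ≠ 0 → x ∈ w ∧ w ∈ Γ) → FunctionalCompression.rateDistortion p f ε ≤ FunctionalCompression.mutualInfo p κ :=
    fun κ _ h0 => by
    rw [hrate]
    refine ENNReal.div_le_div_right (FunctionalCompression.ofReal_sum_log_le_klDiv p κ (A := fun x => {w | x ∈ w})
      (fun x => (Set.toFinite _).measurableSet)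
      (fun x => (hae κ h0 x).mono fun w hw => hw.1) ha ?_) _
    have h1 : ∀ᵐ w ∂(κ ∘ₘ p.toMeasure), w ∈ Γ :=
      Measure.ae_comp_of_ae_ae (Set.toFinite _).measurableSet
        (ae_of_all _ fun x => (hae κ h0 x).mono fun w hw => hw.2)
    filter_upwards [h1] with w hw
    exact hK w hw
  have hX : Nonempty X := ⟨p.support_nonempty.choose⟩
  -- Each maximal hyperedge goes to its centre; the value elsewhere is irrelevant, since `κ` gives
  -- no mass there.
  set c : Set X → Z := fun w => if h : w ∈ Γ then z ⟨w, h⟩ else f hX.some with hc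
  have hcm : Measurable c := measurable_of_finite c
  have hκc : IsMarkovKernel (κ.map c) := Kernel.IsMarkovKernel.map κ hcm
  have hκc0 : FunctionalCompression.channelDistortion p (κ.map c) f ε = 0 := by
    rw [FunctionalCompression.channelDistortion_eq_zero_iff p hp]
    intro x
    have hB : MeasurableSet {v | v ∈ Metric.closedBall (f x) ε} :=
      Metric.isClosed_closedBall.measurableSet
    rw [Kernel.map_apply _ hcm, ae_map_iff hcm.aemeasurable hB]
    filter_upwards [hae κ hκsupp x] with w hw
    rw [hc, Metric.mem_closedBall, dist_comm]
    simpa [hw.2] using hz ⟨w, hw.2⟩ x hw.1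
  refine ⟨⟨⟨κ.map c, hκc, hκc0, ?_⟩, ?_⟩, ⟨⟨κ, hκM, hκsupp, ?_⟩, ?_⟩, hΓfin⟩
  · exact le_antisymm (hlowZ _ hκc hκc0) ((FunctionalCompression.mutualInfo_map_le p κ hcm).trans hκup)
  · rintro _ ⟨κ', h1, h2, rfl⟩
    exact hlowZ κ' h1 h2
  · exact le_antisymm (hlowW κ hκM hκsupp) hκup
  · rintro _ ⟨κ', h1, h2, rfl⟩
    exact hlowW κ' h1 h2
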